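/- All graphs are finite and simple. A resolving set of a graph $\Gamma$ is a set $R$ of vertices such that for any two distinct vertices $u,w$ there is $r\in R$ with $d_\Gamma(u,r)\neq d_\Gamma(w,r)$; the metric dimension $\mu(\Gamma)$ is the smallest size of a resolving set. A symmetric $(v,k,\lambda)$ design is a pair $(X,\mathcal B)$ where $X$ is a set of $v$ points and $\mathcal B$ is a set of $k$-subsets of $X$, called blocks, such that any two distinct points lie in exactly $\lambda$ common blocks and any two distinct blocks meet in exactly $\lambda$ points. It is nontrivial if $2\le k\le v-2$. Its incidence graph is the bipartite graph with vertex set $X\cup\mathcal B$ (disjoint union) in which $x\in X$ is adjacent to $B\in\mathcal B$ if and only if $x\in B$. A polarity is a bijection $\sigma:X\to\mathcal B$ which preserves incidence, i.e. $x\in B$ if and only if $\sigma^{-1}(B)\in\sigma(x)$ for all $x\in X$, $B\in\mathcal B$; it is null if $x\notin\sigma(x)$ for every $x\in X$. **Corollary.** Let $\Gamma$ be the incidence graph of a nontrivial symmetric $(v,k,\lambda)$ design with $k\le v/2$ that admits a null polarity. Then, with $\log$ the natural logarithm, (a) $\mu(\Gamma)<4\sqrt v\,\log v$, and (b) $\displaystyle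 \mu(\Gamma)<\frac{4v^2}{k(v-k)}\log v<\frac{8v}{k}\log v$. -/

import Mathlib

/-- A set `R` of vertices is resolving if any two distinct vertices are distinguished by their
distance to some member of `R` (distances are extended: vertices in different components are at
distance `⊤`). -/
def SimpleGraph.IsResolvingSet {V : Type*} (G : SimpleGraph V) (R : Finset V) : Prop :=
  ∀ u w : V, u ≠ w → ∃ r ∈ R, G.edist u r ≠ G.edist w r

/-- The metric dimension of a finite graph: the smallest size of a resolving set. -/
noncomputable def SimpleGraph.metricDimension {V : Type*} [Fintype V] (G : SimpleGraph V) : ℕ :=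
  sInf {n : ℕ | ∃ R : Finset V, G.IsResolvingSet R ∧ R.card = n}

/-- The set defining the metric dimension is nonempty, so the minimum is attained. -/
theorem SimpleGraph.exists_isResolvingSet_card_eq_metricDimension {V : Type*} [Fintype V]
    (G : SimpleGraph V) :
    ∃ R : Finset V, G.IsResolvingSet R ∧ R.card = G.metricDimension := by
  have h : {n : ℕ | ∃ R : Finset V, G.IsResolvingSet R ∧ R.card = n}.Nonempty := by
    refine ⟨_, Finset.univ, fun u w huw => ⟨u, Finset.mem_univ u, fun h => huw ?_⟩, rfl⟩
    rw [SimpleGraph.edist_self] at h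
    exact (SimpleGraph.edist_eq_zero_iff.mp h.symm).symm
  exact Nat.sInf_mem h

/-- A symmetric `(v, k, lam)` design on the point set `X`: a set of `k`-subsets of the `v`-set `X`
(the blocks) such that any two distinct points lie in exactly `lam` common blocks and any two
distinct blocks meet in exactly `lam` points. -/
structure SymmetricDesign (X : Type*) [Fintype X] [DecidableEq X] (v k lam : ℕ) where
  /-- The set of blocks. -/
  blocks : Finset (Finset X)
  card_points : Fintype.card X = v
  card_block : ∀ B ∈ blocks, B.card = k
  card_blocks_through : ∀ x y : X, x ≠ y → (blocks.filter fun B => x ∈ B ∧ y ∈ B).card = lam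
  card_inter : ∀ A ∈ blocks, ∀ B ∈ blocks, A ≠ B → (A ∩ B).card = lam

namespace SymmetricDesign

variable {X : Type*} [Fintype X] [DecidableEq X] {v k lam : ℕ}

/-- The type of blocks. -/
abbrev Block (D : SymmetricDesign X v k lam) : Type _ := {B : Finset X // B ∈ D.blocks}

/-- The incidence graph: points and blocks are the vertices, and a point is adjacent to the blocks
that contain it. -/
def incidenceGraph (D : SymmetricDesign X v k lam) : SimpleGraph (X ⊕ D.Block) where
  Adj
    | .inl x, .inr B => x ∈ B.1
    | .inr B, .inl x => x ∈ B.1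
    | _, _ => False
  symm := ⟨by
    rintro (x | A) (y | B) h
    · exact h
    · exact h
    · exact h
    · exact h⟩
  loopless := ⟨by
    rintro (x | B) h
    · exact h
    · exact h⟩

/-- A design is nontrivial if `2 ≤ k ≤ v - 2`. -/
def IsNontrivial (_D : SymmetricDesign X v k lam) : Prop := 1 < k ∧ k + 1 < v

/-- A bijection `σ` from points to blocks is a polarity if, together with its inverse, it preserves
incidence: `x` lies on `B` if and only if the point `σ⁻¹ B` lies on the block `σ x`. -/
def IsPolarity (D : SymmetricDesign X v k lam) (σ : X ≃ D.Block) : Prop :=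
  ∀ (x : X) (B : D.Block), x ∈ B.1 ↔ σ.symm B ∈ (σ x).1

/-- A polarity is null if it has no absolute points, that is, no point lies on its image. -/
def IsNullPolarity (D : SymmetricDesign X v k lam) (σ : X ≃ D.Block) : Prop :=
  D.IsPolarity σ ∧ ∀ x : X, x ∉ (σ x).1

end SymmetricDesign

/-! A polarity `σ` lets one point set serve both sides of the bipartition. If `S` meets every `σ x ∆
σ y` with `x ≠ y`, then `S` separates blocks, `σ(S)` separates points, and any point of `S`
separates points from blocks by parity. These symmetric differences have size `2n`, `n = k - lam`,
so counting tuples that miss one of them gives such an `S` with fewer than `(v/n) log v + 1`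
elements. The bounds follow from `n (v - 1) = k (v - k)` and `v ≤ n² + n + 1`. -/

/-- If `m` sets of size at least `d` in a `v`-set satisfy `m (v - d) ^ t < v ^ t`, they have a
common transversal with at most `t` elements. -/
theorem Finset.exists_card_le_forall_inter_nonempty {X ι : Type*} [Fintype X] [DecidableEq X]
    (I : Finset ι) (A : ι → Finset X) (d t : ℕ) (hA : ∀ i ∈ I, d ≤ (A i).card)
    (h : I.card * (Fintype.card X - d) ^ t < Fintype.card X ^ t) :
    ∃ S : Finset X, S.card ≤ t ∧ ∀ i ∈ I, ∃ s ∈ S, s ∈ A i := by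
  classical
  set bad : Finset (Fin t → X) := I.biUnion fun i => Fintype.piFinset fun _ => (A i)ᶜ
  have hbad : bad.card < (Finset.univ : Finset (Fin t → X)).card := by
    calc bad.card ≤ I.card * (Fintype.card X - d) ^ t := by
          refine Finset.card_biUnion_le_card_mul _ _ _ fun i hi => ?_
          rw [Fintype.card_piFinset_const, Finset.card_compl]
          exact Nat.pow_le_pow_left (Nat.sub_le_sub_left (hA i hi) _) _
      _ < _ := by simpa using h
  obtain ⟨f, -, hf⟩ := Finset.exists_mem_notMem_of_card_lt_card hbad
  refine ⟨Finset.univ.image f, Finset.card_image_le.trans (by simp), fun i hi => ?_⟩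
  by_contra! hc
  refine hf (Finset.mem_biUnion.mpr ⟨i, hi, Fintype.mem_piFinset.mpr fun j => ?_⟩)
  simpa using hc (f j) (by simp)

theorem SimpleGraph.IsResolvingSet.metricDimension_le {V : Type*} [Fintype V] {G : SimpleGraph V}
    {R : Finset V} (h : G.IsResolvingSet R) : G.metricDimension ≤ R.card :=
  Nat.sInf_le ⟨R, h, rfl⟩

/-- In a finite `v`-set, a family of at most `v (v - 1)` sets of size `2 n` has a transversal of
size less than `(v / n) log v + 1`. -/
theorem Finset.exists_transversal_of_pairs {X : Type*} [Fintype X] [DecidableEq X]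
    (A : X × X → Finset X) (n : ℕ) (hn : 0 < n) (hX : 2 ≤ Fintype.card X)
    (hA : ∀ p ∈ (Finset.univ : Finset X).offDiag, (A p).card = 2 * n) :
    ∃ S : Finset X,
      (S.card : ℝ) < (Fintype.card X : ℝ) / n * Real.log (Fintype.card X) + 1 ∧
      ∀ p ∈ (Finset.univ : Finset X).offDiag, ∃ s ∈ S, s ∈ A p := by
  set v := Fintype.card X
  set t := ⌈(v : ℝ) / n * Real.log v⌉₊
  have hv : (2 : ℝ) ≤ v := by exact_mod_cast hX
  have hn' : (0 : ℝ) < n := by exact_mod_cast hn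
  have hlog : 0 < Real.log v := Real.log_pos (by linarith)
  have hd : 2 * n ≤ v := by
    have : Nontrivial X := Fintype.one_lt_card_iff_nontrivial.mp hX
    obtain ⟨x, y, hxy⟩ := exists_pair_ne X
    rw [← hA (x, y) (by simpa using hxy)]
    exact Finset.card_le_univ _
  have ht : (v : ℝ) / n * Real.log v ≤ t := Nat.le_ceil _
  -- `(1 - 2n/v)^t ≤ exp(-2nt/v) ≤ v⁻²`, which beats the fewer than `v²` ordered pairs.
  have hpow : ((v - 2 * n : ℕ) : ℝ) ^ t * (v : ℝ) ^ 2 ≤ (v : ℝ) ^ t := by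
    have h1 : ((v - 2 * n : ℕ) : ℝ) ≤ v * Real.exp (-(2 * n / v)) := by
      rw [Nat.cast_sub hd]
      have h := Real.add_one_le_exp (-(2 * n / v : ℝ))
      have h2 := mul_le_mul_of_nonneg_left h (by linarith : (0 : ℝ) ≤ v)
      refine le_trans (le_of_eq ?_) h2
      push_cast
      field_simp
      ring
    have h2 : Real.exp (-(2 * n / v)) ^ t * (v : ℝ) ^ 2 ≤ 1 := by
      have h3 : (v : ℝ) ^ 2 = Real.exp (2 * Real.log v) := by
        rw [mul_comm, Real.exp_mul, Real.exp_log (by linarith)]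
        norm_num
      rw [h3, ← Real.exp_nat_mul, ← Real.exp_add, Real.exp_le_one_iff]
      have h4 : Real.log v ≤ t * (n / v) := by
        calc Real.log v = (v : ℝ) / n * Real.log v * (n / v) := by field_simp
          _ ≤ _ := by gcongr
      have h5 : (t : ℝ) * -(2 * n / v) = -2 * (t * (n / v)) := by ring
      linarith
    calc ((v - 2 * n : ℕ) : ℝ) ^ t * (v : ℝ) ^ 2
        ≤ (v * Real.exp (-(2 * n / v))) ^ t * (v : ℝ) ^ 2 := by gcongr
      _ = (v : ℝ) ^ t * (Real.exp (-(2 * n / v)) ^ t * (v : ℝ) ^ 2) := by ring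
      _ ≤ (v : ℝ) ^ t * 1 := by gcongr
      _ = (v : ℝ) ^ t := mul_one _
  have hpow' : (v - 2 * n) ^ t * v ^ 2 ≤ v ^ t := by exact_mod_cast hpow
  obtain ⟨S, hS, hit⟩ := Finset.exists_card_le_forall_inter_nonempty
    (Finset.univ : Finset X).offDiag A (2 * n) t (fun p hp => (hA p hp).ge) (by
      rw [Finset.offDiag_card, Finset.card_univ]
      change (v * v - v) * (v - 2 * n) ^ t < v ^ t
      have hvt : 0 < v ^ t := by positivity
      rcases Nat.eq_zero_or_pos ((v - 2 * n) ^ t) with h0 | h0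
      · rwa [h0, mul_zero]
      · refine lt_of_lt_of_le ?_ hpow'
        rw [mul_comm]
        refine Nat.mul_lt_mul_of_pos_left ?_ h0
        rw [sq]
        exact Nat.sub_lt (by positivity) (by omega))
  refine ⟨S, lt_of_le_of_lt (by exact_mod_cast hS) (Nat.ceil_lt_add_one (by positivity)), hit⟩

/-! ### Resolving sets from a polarity -/

namespace SymmetricDesign

variable {X : Type*} [Fintype X] [DecidableEq X] {v k lam : ℕ} {D : SymmetricDesign X v k lam}

theorem IsPolarity.mem_comm {σ : X ≃ D.Block} (hσ : D.IsPolarity σ) (x y : X) :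
    x ∈ (σ y).1 ↔ y ∈ (σ x).1 := by
  simpa using hσ x (σ y)

theorem card_inter_of_ne (σ : X ≃ D.Block) {x y : X} (h : x ≠ y) :
    ((σ x).1 ∩ (σ y).1).card = lam :=
  D.card_inter _ (σ x).2 _ (σ y).2 fun e => h (σ.injective (Subtype.ext e))

/-- Fix `x` and double count the pairs `(z, y)` with `y ≠ x` and `z ∈ σ x ∩ σ y`. By polarity, `z ∈
σ y` means `y ∈ σ z`, so each `z` has `k - 1` partners. -/
theorem IsPolarity.mul_pred_eq {σ : X ≃ D.Block} (hσ : D.IsPolarity σ) (hv : 0 < v) :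
    k * (k - 1) = lam * (v - 1) := by
  have : Nonempty X := Fintype.card_pos_iff.mp (D.card_points ▸ hv)
  obtain ⟨x⟩ := this
  have h := Finset.sum_card_bipartiteAbove_eq_sum_card_bipartiteBelow
    (s := (σ x).1) (t := Finset.univ.erase x) fun z y => z ∈ (σ y).1
  rw [Finset.sum_const_nat (m := k - 1), Finset.sum_const_nat (m := lam)] at h
  · rw [D.card_block _ (σ x).2, Finset.card_erase_of_mem (Finset.mem_univ _),
      Finset.card_univ, D.card_points] at h
    rw [h, mul_comm]
  · intro y hy
    refine (congrArg Finset.card ?_).trans (card_inter_of_ne σ (Finset.ne_of_mem_erase hy).symm)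
    ext z
    simp [Finset.bipartiteBelow]
  · intro z hz
    refine Eq.trans (congrArg Finset.card ?_)
      ((Finset.card_erase_of_mem ((hσ.mem_comm z x).mp hz)).trans
        (congrArg (· - 1) (D.card_block _ (σ z).2)))
    ext y
    simp [Finset.bipartiteAbove, hσ.mem_comm z y]

theorem card_symmDiff (σ : X ≃ D.Block) {x y : X} (h : x ≠ y) :
    (symmDiff (σ x).1 (σ y).1).card = 2 * (k - lam) := by
  have h1 := Finset.card_sdiff_add_card_inter (σ x).1 (σ y).1
  have h2 := Finset.card_sdiff_add_card_inter (σ y).1 (σ x).1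
  rw [Finset.inter_comm, card_inter_of_ne σ h.symm, D.card_block _ (σ x).2] at h1
  rw [card_inter_of_ne σ h.symm, D.card_block _ (σ y).2] at h2
  rw [symmDiff_def, Finset.sup_eq_union, Finset.card_union_of_disjoint disjoint_sdiff_sdiff]
  omega

/-- The bipartition of the incidence graph into points and blocks. -/
def incidenceColoring (D : SymmetricDesign X v k lam) : D.incidenceGraph.Coloring Bool :=
  SimpleGraph.Coloring.mk (fun a => a.isLeft) (by
    rintro (x | A) (y | B) h
    · exact h.elim
    · simp
    · simp
    · exact h.elim)

theorem reachable_inl_inl (hlam : 0 < lam) (x y : X) :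
    D.incidenceGraph.Reachable (.inl x) (.inl y) := by
  by_cases h : x = y
  · rw [h]
  · obtain ⟨B, hB⟩ := Finset.card_pos.mp (hlam.trans_eq (D.card_blocks_through x y h).symm)
    rw [Finset.mem_filter] at hB
    have h1 : D.incidenceGraph.Adj (.inl x) (.inr ⟨B, hB.1⟩) := hB.2.1
    have h2 : D.incidenceGraph.Adj (.inr ⟨B, hB.1⟩) (.inl y) := hB.2.2
    exact h1.reachable.trans h2.reachable

/-- Walks to `s` from a point and from a block have lengths of opposite parity. Positivity of `lam`
gives reachability, so the two distances are not both `⊤`. -/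
theorem edist_inl_ne_edist_inr (hlam : 0 < lam) (x s : X) (B : D.Block) :
    D.incidenceGraph.edist (.inl x) (.inl s) ≠ D.incidenceGraph.edist (.inr B) (.inl s) := by
  intro h
  have hr := reachable_inl_inl (D := D) hlam x s
  obtain ⟨p, hp⟩ := hr.exists_walk_length_eq_edist
  have hr' : D.incidenceGraph.Reachable (.inr B) (.inl s) := by
    rw [← SimpleGraph.edist_ne_top_iff_reachable, ← h]
    exact SimpleGraph.edist_ne_top_iff_reachable.mpr hr
  obtain ⟨q, hq⟩ := hr'.exists_walk_length_eq_edist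
  have hpq : p.length = q.length := by
    have : (p.length : ℕ∞) = q.length := by rw [hp, hq, h]
    exact_mod_cast this
  have e1 := D.incidenceColoring.even_length_iff_congr p
  have e2 := D.incidenceColoring.even_length_iff_congr q
  rw [hpq, e2] at e1
  change ((false = true) ↔ (true = true)) ↔ ((true = true) ↔ (true = true)) at e1
  simp at e1

theorem edist_ne_of_adj_of_not_adj {V : Type*} {G : SimpleGraph V} {u w r : V}
    (h : ¬(G.Adj u r ↔ G.Adj w r)) : G.edist u r ≠ G.edist w r := by
  rw [← SimpleGraph.edist_eq_one_iff_adj, ← SimpleGraph.edist_eq_one_iff_adj] at h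
  exact fun e => h (by rw [e])

theorem IsPolarity.isResolvingSet {σ : X ≃ D.Block} (hσ : D.IsPolarity σ) (hlam : 0 < lam)
    {S : Finset X} (hS0 : S.Nonempty)
    (hS : ∀ x y : X, x ≠ y → ∃ s ∈ S, s ∈ symmDiff (σ x).1 (σ y).1) :
    D.incidenceGraph.IsResolvingSet (S.disjSum (S.map σ.toEmbedding)) := by
  obtain ⟨s₀, hs₀⟩ := hS0
  rintro (x | A) (y | B) hne
  · obtain ⟨s, hs, hsm⟩ := hS x y fun h => hne (by rw [h])
    refine ⟨.inr (σ s), by simpa using hs, edist_ne_of_adj_of_not_adj ?_⟩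
    change ¬(x ∈ (σ s).1 ↔ y ∈ (σ s).1)
    rw [hσ.mem_comm x, hσ.mem_comm y]
    rw [Finset.mem_symmDiff] at hsm
    tauto
  · exact ⟨.inl s₀, by simpa using hs₀, edist_inl_ne_edist_inr hlam _ _ _⟩
  · exact ⟨.inl s₀, by simpa using hs₀, (edist_inl_ne_edist_inr hlam _ _ _).symm⟩
  · obtain ⟨s, hs, hsm⟩ := hS (σ.symm A) (σ.symm B) fun h => hne (by rw [σ.symm.injective h])
    refine ⟨.inl s, by simpa using hs, edist_ne_of_adj_of_not_adj ?_⟩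
    change ¬(s ∈ A.1 ↔ s ∈ B.1)
    rw [Finset.mem_symmDiff, σ.apply_symm_apply, σ.apply_symm_apply] at hsm
    tauto

theorem IsPolarity.metricDimension_lt {σ : X ≃ D.Block} (hσ : D.IsPolarity σ) (hlam : 0 < lam)
    (hlt : lam < k) (hv : 2 ≤ v) :
    (D.incidenceGraph.metricDimension : ℝ) <
      2 * ((v : ℝ) / ((k : ℝ) - lam) * Real.log v + 1) := by
  obtain ⟨S, hcard, hS⟩ := Finset.exists_transversal_of_pairs
    (fun p : X × X => symmDiff (σ p.1).1 (σ p.2).1) (k - lam) (by omega)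
    (by rwa [D.card_points]) fun p hp => card_symmDiff σ (by simpa using hp)
  rw [D.card_points, Nat.cast_sub hlt.le] at hcard
  have hS' : ∀ x y : X, x ≠ y → ∃ s ∈ S, s ∈ symmDiff (σ x).1 (σ y).1 := fun x y h =>
    hS (x, y) (by simpa using h)
  have : Nontrivial X := Fintype.one_lt_card_iff_nontrivial.mp (by rw [D.card_points]; exact hv)
  obtain ⟨x, y, hxy⟩ := exists_pair_ne X
  obtain ⟨s, hs, -⟩ := hS' x y hxy
  have hR := (hσ.isResolvingSet hlam ⟨s, hs⟩ hS').metricDimension_le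
  rw [Finset.card_disjSum, Finset.card_map] at hR
  have : (D.incidenceGraph.metricDimension : ℝ) ≤ S.card + S.card := by exact_mod_cast hR
  linarith

end SymmetricDesign

/-- A solution of the symmetric design equation `k (k - 1) = l (v - 1)` has `v ≠ 2 k`
unless `k = 1`. -/
theorem two_mul_ne_of_mul_pred_eq {v k l : ℕ} (hk : 1 < k) (h : k * (k - 1) = l * (v - 1)) :
    v ≠ 2 * k := by
  rintro rfl
  obtain ⟨j, rfl⟩ : ∃ j, k = j + 1 := ⟨k - 1, by omega⟩
  -- Here `v - 1 = 2j + 1` is coprime to `k = j + 1`, so it would have to divide `j = k - 1 > 0`.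
  have hc1 : Nat.Coprime (2 * j + 1) (j + 1) := by
    have : 2 * j + 1 = j + (j + 1) := by ring
    rw [this]
    simp
  have hc2 : Nat.Coprime (2 * j + 1) j := by simp [mul_comm 2 j]
  have hd : 2 * j + 1 ∣ (j + 1) * j :=
    ⟨l, by
      rw [Nat.add_sub_cancel, show 2 * (j + 1) - 1 = 2 * j + 1 by omega] at h
      rw [h, mul_comm]⟩
  have := Nat.le_of_dvd (by omega) (hc1.dvd_of_dvd_mul_left hd)
  omega

theorem mainTheorem9 {X : Type*} [Fintype X] [DecidableEq X] {v k lam : ℕ}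
    (D : SymmetricDesign X v k lam) (hnontriv : D.IsNontrivial)
    (hk : (k : ℝ) ≤ (v : ℝ) / 2)
    (hnull : ∃ σ : X ≃ D.Block, D.IsNullPolarity σ) :
    (D.incidenceGraph.metricDimension : ℝ) < 4 * Real.sqrt (v : ℝ) * Real.log (v : ℝ) ∧
    (D.incidenceGraph.metricDimension : ℝ)
      < 4 * (v : ℝ) ^ 2 / ((k : ℝ) * ((v : ℝ) - (k : ℝ))) * Real.log (v : ℝ) ∧
    4 * (v : ℝ) ^ 2 / ((k : ℝ) * ((v : ℝ) - (k : ℝ))) * Real.log (v : ℝ)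
      < 8 * (v : ℝ) / (k : ℝ) * Real.log (v : ℝ) := by
  obtain ⟨σ, hσ, -⟩ := hnull
  obtain ⟨hk1, hkv⟩ := hnontriv
  have hkey := hσ.mul_pred_eq (by omega)
  have hlam : 0 < lam := by
    rcases Nat.eq_zero_or_pos lam with h | h
    · rw [h, zero_mul, Nat.mul_eq_zero] at hkey
      omega
    · exact h
  have hkR : (2 : ℝ) ≤ k := by exact_mod_cast hk1
  have hkvR : (k : ℝ) + 2 ≤ v := by exact_mod_cast hkv
  have hlamR : (1 : ℝ) ≤ lam := by exact_mod_cast hlam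
  have hkeyR : (k : ℝ) * (k - 1) = lam * (v - 1) := by
    have := congrArg (Nat.cast : ℕ → ℝ) hkey
    rwa [Nat.cast_mul, Nat.cast_mul, Nat.cast_sub (by omega), Nat.cast_sub (by omega),
      Nat.cast_one] at this
  have hlt : lam < k := by
    have : (lam : ℝ) < k := by nlinarith
    exact_mod_cast this
  have hbound := hσ.metricDimension_lt hlam hlt (by omega)
  have hstrict : (k : ℝ) < v / 2 := by
    refine lt_of_le_of_ne hk fun h => two_mul_ne_of_mul_pred_eq hk1 hkey ?_
    have : (v : ℝ) = 2 * k := by linarith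
    exact_mod_cast this
  -- Order `n = 1` would force `k = 1` or `k = v - 1`.
  have hn : (2 : ℝ) ≤ k - lam := by
    have h1 : lam + 1 ≠ k := by
      intro h
      have h' : (k : ℝ) = lam + 1 := by exact_mod_cast h.symm
      have : ((k : ℝ) - 1) * (v - k - 1) = 0 := by
        have : (lam : ℝ) = k - 1 := by linarith
        rw [this] at hkeyR
        linarith
      rcases mul_eq_zero.mp this with h | h <;> linarith
    have : lam + 2 ≤ k := by omega
    have : (lam : ℝ) + 2 ≤ k := by exact_mod_cast this
    linarith
  -- Since `v ≥ 4 > e`, the `+ 1` left by rounding up can be absorbed into a multiple of `log v`.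
  have hlog : 1 < Real.log v := by
    rw [Real.lt_log_iff_exp_lt (by linarith)]
    linarith [Real.exp_one_lt_d9]
  set L := Real.log v
  set n : ℝ := k - lam with hndef
  have hnk : n * (v - 1) = k * (v - k) := by rw [hndef]; linarith
  have hP : 0 < (k : ℝ) * (v - k) := mul_pos (by linarith) (by linarith)
  refine ⟨?_, ?_, ?_⟩
  · refine hbound.trans_le ?_
    set s := Real.sqrt v
    have hs : s ^ 2 = v := Real.sq_sqrt (by linarith)
    have hs0 : 0 ≤ s := Real.sqrt_nonneg _
    have hs2 : 2 ≤ s := Real.le_sqrt_of_sq_le (by linarith)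
    -- The second factor is the `lam` of the complementary design. Both factors are at least 1 and
    -- sum to `v - 2n`; as `a + b ≤ ab + 1` for `a, b ≥ 1`, this yields `v ≤ n² + n + 1`.
    have hprod : (lam : ℝ) * (v - 2 * k + lam) = n * (n - 1) := by rw [hndef]; linarith
    have hvn : (v : ℝ) ≤ n ^ 2 + n + 1 := by
      have : 0 ≤ ((lam : ℝ) - 1) * (v - 2 * k + lam - 1) :=
        mul_nonneg (by linarith) (by linarith)
      have : (lam : ℝ) + (v - 2 * k + lam) = v - 2 * n := by rw [hndef]; ring
      nlinarith
    have hsn : s ≤ n + 1 := by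
      refine Real.sqrt_le_iff.mpr ⟨by linarith, by nlinarith⟩
    have hmain : (v : ℝ) + n ≤ 2 * s * n := by
      nlinarith [mul_nonneg (sub_nonneg.mpr hs2) (sub_nonneg.mpr hsn)]
    have hdiv : (v : ℝ) / n + 1 ≤ 2 * s := by
      rw [div_add_one (by linarith), div_le_iff₀ (by linarith)]
      exact hmain
    nlinarith
  · refine hbound.trans_le ?_
    have hdiv : (v : ℝ) / n = v * (v - 1) / (k * (v - k)) := by
      rw [← hnk]
      have : (v : ℝ) - 1 ≠ 0 := by linarith
      field_simp
    have hle : (1 : ℝ) ≤ v ^ 2 / (k * (v - k)) := by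
      rw [one_le_div hP]
      nlinarith
    have h1 : (v : ℝ) / n ≤ v ^ 2 / (k * (v - k)) := by
      rw [hdiv]
      gcongr
      nlinarith
    have h2 : 4 * (v : ℝ) ^ 2 / (k * (v - k)) = 4 * (v ^ 2 / (k * (v - k))) := by ring
    rw [h2]
    nlinarith
  · refine mul_lt_mul_of_pos_right ?_ (by linarith)
    have hvk : 0 < (v : ℝ) - k := by linarith
    rw [div_lt_div_iff₀ hP (by linarith)]
    have : 0 < 4 * (v : ℝ) * k * (v - 2 * k) :=
      mul_pos (by nlinarith) (by linarith)
    nlinarith
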